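/- Let $I=\prod_{i=1}^n[a_i,b_i]$ (with $a_i<b_i$) be a brick in $\mathbb R^n$ and let $\mu$ denote the volume of bricks. A division $\mathcal D$ of $I$ is a finite set of non-overlapping bricks $J$ with union $I$, each with an associated point $P\in J$; given $\delta\colon I\to(0,\infty)$, it is compatible with $\delta$ if each $J$ lies in the ball with centre $P$ and radius $\delta(P)$. A real function $f$ on $I$ is (gauge) integrable over $I$ with $\int_I f\,d\mu=F\in\mathbb R$ if for every $\varepsilon>0$ there is $\delta\colon I\to(0,\infty)$ with $\bigl|(\mathcal D)\sum f(P)\mu(J)-F\bigr|<\varepsilon$ for all divisions $\mathcal D$ of $I$ compatible with $\delta$. A property holds almost everywhere in $I$ if the set $X$ of points where it fails satisfies $\inf_{\delta}\sup_{\mathcal D}(\mathcal D)\sum\chi_X(P)\mu(J)=0$, where $\mathcal D$ runs over the divisions of $I$ compatible with $\delta$ and $\delta$ over all positive functions. An extended-real-valued function that is finite almost everywhere in $I$ is integrated by replacing its infinite values by $0$; its integral exists if the function so obtained is integrable. Let $f_j\colon I\to\mathbb R$ ($j=1,2,\dots$) be integrable over $I$. Lower and upper limits are taken in $[-\infty,\infty]$.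 (a) If there is an integrable $g_1\colon I\to\mathbb R$ with $f_j(P)\ge g_1(P)$ for all $j$ and all $P\in I$, then $$\int_I\liminf_{j\to\infty}f_j\,d\mu\;\le\;\liminf_{j\to\infty}\int_I f_j\,d\mu$$ whenever the left-hand integral exists; and if the right-hand side is not $+\infty$, then $\liminf_j f_j$ is finite almost everywhere in $I$ and the left-hand integral exists. (b) If there is an integrable $g_2\colon I\to\mathbb R$ with $f_j(P)\le g_2(P)$ for all $j$ and all $P\in I$, then $$\int_I\limsup_{j\to\infty}f_j\,d\mu\;\ge\;\limsup_{j\to\infty}\int_I f_j\,d\mu$$ whenever the left-hand integral exists; and if the right-hand side is not $-\infty$, then $\limsup_j f_j$ is finite almost everywhere in $I$ and the left-hand integral exists. (c) If there are integrable $g_1,g_2\colon I\to\mathbb R$ with $g_1(P)\le f_j(P)\le g_2(P)$ for all $j$ and all $P\in I$, and if $f\colon I\to\mathbb R$ satisfies $f_j(P)\to f(P)$ for almost every $P\in I$, then $f$ is integrable over $I$, $\lim_{j\to\infty}\int_I f_j\,d\mu$ exists, and $$\int_I f\,d\mu=\lim_{j\to\infty}\int_I f_j\,d\mu.$$ -/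

import Mathlib

open MeasureTheory Filter Topology
open scoped ENNReal

noncomputable section

namespace GaugeIntegral

variable {n : ℕ}

/-- `f` has the gauge (generalized Riemann, Henstock–Kurzweil) integral `F` over the brick `I`
with respect to the volume `μ`: the sums `∑ f(P) μ(J)` over the divisions of `I` into bricks `J`
with associated points `P ∈ J` tend to `F` along the gauges `δ(P) > 0`. Points of the brick are the
points of the closed box `BoxIntegral.Box.Icc I`. -/
def HasGaugeIntegral (I : BoxIntegral.Box (Fin n)) (f : (Fin n → ℝ) → ℝ) (F : ℝ) : Prop :=
  BoxIntegral.HasIntegral I BoxIntegral.IntegrationParams.Henstock f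
    BoxIntegral.BoxAdditiveMap.volume F

/-- `f` is gauge integrable over the brick `I`. -/
def GaugeIntegrable (I : BoxIntegral.Box (Fin n)) (f : (Fin n → ℝ) → ℝ) : Prop :=
  BoxIntegral.Integrable I BoxIntegral.IntegrationParams.Henstock f
    BoxIntegral.BoxAdditiveMap.volume

/-- The gauge integral of `f` over `I` (used only for gauge integrable `f`). -/
def gaugeIntegral (I : BoxIntegral.Box (Fin n)) (f : (Fin n → ℝ) → ℝ) : ℝ :=
  BoxIntegral.integral I BoxIntegral.IntegrationParams.Henstock f
    BoxIntegral.BoxAdditiveMap.volume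

/-- `V(χ(X,·)μ; I; δ)`: the supremum of `∑ χ(X,P) μ(J)` over all divisions of `I` that are
compatible with the gauge `δ`. -/
def variation (I : BoxIntegral.Box (Fin n)) (X : Set (Fin n → ℝ))
    (δ : (Fin n → ℝ) → Set.Ioi (0 : ℝ)) : ℝ≥0∞ :=
  ⨆ (π : BoxIntegral.TaggedPrepartition I) (_ : π.IsPartition) (_ : π.IsHenstock)
    (_ : π.IsSubordinate δ),
    ∑ J ∈ π.boxes, X.indicator (fun _ => volume (J : Set (Fin n → ℝ))) (π.tag J)

/-- The outer measure of `X` in the brick `I`: the infimum of `V(χ(X,·)μ; I; δ)` over all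
gauges `δ`. -/
def outerMeasure (I : BoxIntegral.Box (Fin n)) (X : Set (Fin n → ℝ)) : ℝ≥0∞ :=
  ⨅ δ : (Fin n → ℝ) → Set.Ioi (0 : ℝ), variation I X δ

/-- `p` is true almost everywhere in the brick `I`. -/
def AlmostEverywhere (I : BoxIntegral.Box (Fin n)) (p : (Fin n → ℝ) → Prop) : Prop :=
  outerMeasure I {P | ¬ p P} = 0

/-- The extended-real-valued function `φ` is finite almost everywhere in `I` and has the gauge
integral `F` over `I`, when the value `0` is put in place of its infinite values
(`EReal.toReal` sends `±∞` to `0`). -/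
def HasExtendedGaugeIntegral (I : BoxIntegral.Box (Fin n)) (φ : (Fin n → ℝ) → EReal)
    (F : ℝ) : Prop :=
  AlmostEverywhere I (fun P => φ P ≠ ⊥ ∧ φ P ≠ ⊤) ∧ HasGaugeIntegral I (fun P => (φ P).toReal) F

end GaugeIntegral

end

/-! A gauge integrable function need not be Lebesgue integrable, but a nonnegative one is. Hence
each `f j - g₁` is Lebesgue integrable with integral the difference of the gauge integrals, and
Lebesgue's Fatou lemma and dominated convergence apply to these differences; adding `g₁` back gives
the gauge statements. Upper limits follow by negation.

The point to prove is `HasGaugeIntegral.integrableOn_of_nonneg`, whose core is measurability. The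
Saks–Henstock lemma shows that averages over shrinking dyadic boxes converge almost everywhere to
the function, and those averages are measurable. The same lemma, applied to an indicator, identifies
null sets in the gauge sense with Lebesgue null sets (`almostEverywhere_iff`). -/

namespace GaugeIntegral

open BoxIntegral

variable {n : ℕ}

/-! ### Dyadic subdivision of a box -/

/-- The box of the `k`-th dyadic subdivision of `I` that contains the point `x` of `I`. -/
noncomputable def dyadicBox : ℕ → Box (Fin n) → (Fin n → ℝ) → Box (Fin n)
  | 0, I, _ => I
  | k + 1, I, x => dyadicBox k (I.splitCenterBox {i | (I.lower i + I.upper i) / 2 < x i}) x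

theorem mem_dyadicBox (k : ℕ) {I : Box (Fin n)} {x : Fin n → ℝ} (hx : x ∈ I) :
    x ∈ dyadicBox k I x := by
  induction k generalizing I with
  | zero => exact hx
  | succ k ih => exact ih (Box.mem_splitCenterBox.2 ⟨hx, fun _ => Iff.rfl⟩)

theorem upper_sub_lower_dyadicBox (k : ℕ) (I : Box (Fin n)) (x : Fin n → ℝ) (i : Fin n) :
    (dyadicBox k I x).upper i - (dyadicBox k I x).lower i = (I.upper i - I.lower i) / 2 ^ k := by
  induction k generalizing I with
  | zero => simp [dyadicBox]
  | succ k ih =>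
    rw [dyadicBox, ih, Box.upper_sub_lower_splitCenterBox, pow_succ', div_div]

theorem boxVolume_apply (J : Box (Fin n)) (y : ℝ) :
    BoxAdditiveMap.volume J y = volume.real (J : Set (Fin n → ℝ)) * y :=
  rfl

/-- Each level has finitely many boxes, selected by coordinate inequalities, so the function is a
measurable step function whatever `G` is. -/
theorem measurable_comp_dyadicBox (G : Box (Fin n) → ℝ) (k : ℕ) (I : Box (Fin n)) :
    Measurable fun x => G (dyadicBox k I x) := by
  induction k generalizing I with
  | zero => exact (measurable_const : Measurable fun _ : Fin n → ℝ => G I)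
  | succ k ih =>
    have hpiece : ∀ s : Set (Fin n),
        MeasurableSet {x : Fin n → ℝ | {i | (I.lower i + I.upper i) / 2 < x i} = s} := by
      intro s
      have : {x : Fin n → ℝ | {i | (I.lower i + I.upper i) / 2 < x i} = s} =
          ⋂ i, {x | (I.lower i + I.upper i) / 2 < x i ↔ i ∈ s} := by
        ext x
        simp [Set.ext_iff]
      rw [this]
      refine MeasurableSet.iInter fun i => ?_
      by_cases hi : i ∈ s
      · simpa [hi] using measurableSet_lt measurable_const (measurable_pi_apply i)
      · simpa [hi] using measurableSet_le (measurable_pi_apply i) measurable_const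
    intro t ht
    have : (fun x => G (dyadicBox (k + 1) I x)) ⁻¹' t =
        ⋃ s : Set (Fin n), {x | {i | (I.lower i + I.upper i) / 2 < x i} = s} ∩
          (fun x => G (dyadicBox k (I.splitCenterBox s) x)) ⁻¹' t := by
      ext x
      simp [dyadicBox]
    rw [this]
    exact MeasurableSet.iUnion fun s => (hpiece s).inter (ih _ ht)

theorem eventually_Icc_dyadicBox_subset {I : Box (Fin n)} {x : Fin n → ℝ} (hx : x ∈ I)
    {r : ℝ} (hr : 0 < r) :
    ∀ᶠ k in atTop, Box.Icc (dyadicBox k I x) ⊆ Metric.closedBall x r := by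
  have hlim : Tendsto (fun k : ℕ => dist I.lower I.upper / 2 ^ k) atTop (𝓝 0) := by
    simpa [div_eq_mul_inv] using (tendsto_pow_atTop_nhds_zero_of_lt_one (r := (2 : ℝ)⁻¹)
      (by norm_num) (by norm_num)).const_mul (dist I.lower I.upper)
  filter_upwards [hlim.eventually_lt_const hr] with k hk y hy
  rw [Metric.mem_closedBall, dist_pi_le_iff hr.le]
  intro i
  have hxk := Box.coe_subset_Icc (mem_dyadicBox k hx)
  have hlen := upper_sub_lower_dyadicBox k I x i
  have hdist : I.upper i - I.lower i ≤ dist I.lower I.upper := by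
    refine le_trans ?_ (dist_le_pi_dist I.lower I.upper i)
    rw [dist_comm, Real.dist_eq]
    exact le_abs_self _
  have hdiv : (I.upper i - I.lower i) / 2 ^ k ≤ dist I.lower I.upper / 2 ^ k := by gcongr
  have h₁ := hxk.1 i
  have h₂ := hxk.2 i
  have h₃ := hy.1 i
  have h₄ := hy.2 i
  rw [Real.dist_eq, abs_le]
  constructor <;> linarith

/-- Stopping rule: keep a box as soon as it satisfies `G`, otherwise split it. The maximal good
boxes down to level `k` are disjoint, so this replaces a Vitali covering argument. -/
theorem exists_prepartition_of_dyadicBox (G : Box (Fin n) → Prop) (k : ℕ) (I : Box (Fin n)) :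
    ∃ π : Prepartition I, (∀ J ∈ π, G J) ∧
      ∀ x ∈ I, ∀ m ≤ k, G (dyadicBox m I x) → x ∈ π.iUnion := by
  induction k generalizing I with
  | zero =>
    by_cases hI : G I
    · exact ⟨⊤, by simpa using hI, fun x hx _ _ _ => by simpa using hx⟩
    · refine ⟨⊥, by simp, fun x _ m hm hG => ?_⟩
      obtain rfl : m = 0 := by omega
      exact absurd hG hI
  | succ k ih =>
    by_cases hI : G I
    · exact ⟨⊤, by simpa using hI, fun x hx _ _ _ => by simpa using hx⟩
    · choose π hπ hcover using ih
      refine ⟨(Prepartition.splitCenter I).biUnion π, ?_, fun x hx m hm hG => ?_⟩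
      · intro J hJ
        obtain ⟨J', -, hJ'⟩ := Prepartition.mem_biUnion _ |>.1 hJ
        exact hπ J' J hJ'
      · obtain _ | m := m
        · exact absurd hG hI
        · rw [Prepartition.iUnion_biUnion]
          simp only [Set.mem_iUnion]
          exact ⟨_, Prepartition.mem_splitCenter.2 ⟨_, rfl⟩,
            hcover _ x (Box.mem_splitCenterBox.2 ⟨hx, fun _ => Iff.rfl⟩) m (by omega) hG⟩

/-! ### Differentiation and measurability -/

/-- Points at which the integrals over small dyadic boxes fall short of the values of a gauge
integrable function by a fixed proportion form a null set. -/
theorem volume_frequently_integral_add_le {I : Box (Fin n)} {f : (Fin n → ℝ) → ℝ}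
    (hf : GaugeIntegrable I f) {η : ℝ} (hη : 0 < η) :
    volume {x | x ∈ I ∧ ∃ᶠ k in atTop, gaugeIntegral (dyadicBox k I x) f +
      η * volume.real (dyadicBox k I x : Set (Fin n → ℝ)) ≤
        f x * volume.real (dyadicBox k I x : Set (Fin n → ℝ))} = 0 := by
  set S := {x | x ∈ I ∧ ∃ᶠ k in atTop, gaugeIntegral (dyadicBox k I x) f +
      η * volume.real (dyadicBox k I x : Set (Fin n → ℝ)) ≤
        f x * volume.real (dyadicBox k I x : Set (Fin n → ℝ))}
  have key : ∀ ε : ℝ, 0 < ε → volume S ≤ ENNReal.ofReal ε := by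
    intro ε hε
    have hεη : 0 < η * ε := mul_pos hη hε
    -- Saks–Henstock with error `η * ε` will bound `η` times the covered volume, hence that volume
    -- by `ε`.
    set r := BoxIntegral.Integrable.convergenceR hf (η * ε) 0
    set G : Box (Fin n) → Prop := fun J => ∃ x ∈ Box.Icc J,
      Box.Icc J ⊆ Metric.closedBall x (r x) ∧
        gaugeIntegral J f + η * volume.real (J : Set (Fin n → ℝ)) ≤
          f x * volume.real (J : Set (Fin n → ℝ))
    -- A prepartition is finite, so the depth is cut off at `k`; the bound is uniform in `k`.
    set T : ℕ → Set (Fin n → ℝ) := fun k => {x | x ∈ I ∧ ∃ m ≤ k, G (dyadicBox m I x)}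
    have hT : ∀ k, volume (T k) ≤ ENNReal.ofReal ε := by
      intro k
      obtain ⟨π, hπ, hcover⟩ := exists_prepartition_of_dyadicBox G k I
      choose! t ht htr hle using hπ
      classical
      obtain ⟨x₀, hx₀⟩ := I.nonempty_coe
      let τ : TaggedPrepartition I :=
        { toPrepartition := π
          tag := fun J => if J ∈ π then t J else x₀
          tag_mem_Icc := fun J => by
            split_ifs with h
            · exact Box.le_iff_Icc.1 (π.le_of_mem h) (ht J h)
            · exact Box.coe_subset_Icc hx₀ }
      have hτ : ∀ J ∈ π, τ.tag J = t J := fun J hJ => if_pos hJ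
      have hbase : IntegrationParams.Henstock.MemBaseSet I 0 r τ :=
        { isSubordinate := fun J hJ => by rw [hτ J hJ]; exact htr J hJ
          isHenstock := fun _ J hJ => by rw [hτ J hJ]; exact ht J hJ
          distortion_le := fun h => by simp [IntegrationParams.Henstock] at h
          exists_compl := fun h => by simp [IntegrationParams.Henstock] at h }
      have hdist := BoxIntegral.Integrable.dist_integralSum_sum_integral_le_of_memBaseSet hf hεη
        hbase
      have hsum : η * volume.real π.iUnion ≤ η * ε := by
        refine le_trans ?_ ((le_abs_self _).trans (Real.dist_eq _ _ ▸ hdist))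
        rw [π.measure_iUnion_toReal, integralSum, ← Finset.sum_sub_distrib, Finset.mul_sum]
        refine Finset.sum_le_sum fun J hJ => ?_
        have h := hle J hJ
        rw [gaugeIntegral] at h
        rw [hτ J hJ, boxVolume_apply]
        linarith
      have hfin : volume π.iUnion ≠ ∞ :=
        ((measure_mono π.iUnion_subset).trans_lt (I.measure_coe_lt_top volume)).ne
      calc volume (T k) ≤ volume π.iUnion :=
            measure_mono fun x hx => by
              obtain ⟨hxI, m, hm, hGm⟩ := hx
              exact hcover x hxI m hm hGm
        _ ≤ ENNReal.ofReal ε := by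
            rw [← ofReal_measureReal hfin]
            exact ENNReal.ofReal_le_ofReal (le_of_mul_le_mul_left hsum hη)
    have hmono : Monotone T := fun k l hkl x hx =>
      ⟨hx.1, hx.2.imp fun m hm => ⟨hm.1.trans hkl, hm.2⟩⟩
    have hsub : S ⊆ ⋃ k, T k := by
      intro x hx
      -- Infinitely many levels are bad and all late ones fit the gauge at `x`, so some bad box
      -- admits `x` itself as tag.
      obtain ⟨k, hk, hk'⟩ :=
        (hx.2.and_eventually (eventually_Icc_dyadicBox_subset hx.1 (r x).2)).exists
      exact Set.mem_iUnion.2 ⟨k, hx.1, k, le_rfl, x,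
        Box.coe_subset_Icc (mem_dyadicBox k hx.1), hk', hk⟩
    refine (measure_mono hsub).trans ?_
    rw [hmono.measure_iUnion]
    exact iSup_le hT
  refine le_antisymm (ENNReal.le_of_forall_pos_le_add fun ε hε _ => ?_) zero_le
  simpa using key ε hε

theorem volume_coe_box_pos (I : Box (Fin n)) : 0 < volume.real (I : Set (Fin n → ℝ)) := by
  rw [measureReal_def, Box.volume_apply']
  exact Finset.prod_pos fun i _ => sub_pos.2 (I.lower_lt_upper i)

/-- Differentiation of the gauge integral along dyadic boxes. -/
theorem ae_tendsto_dyadic_average {I : Box (Fin n)} {f : (Fin n → ℝ) → ℝ}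
    (hf : GaugeIntegrable I f) :
    ∀ᵐ x ∂volume.restrict (I : Set (Fin n → ℝ)), Tendsto (fun k =>
      gaugeIntegral (dyadicBox k I x) f / volume.real (dyadicBox k I x : Set (Fin n → ℝ)))
      atTop (𝓝 (f x)) := by
  have hneg : ∀ J : Box (Fin n), gaugeIntegral J (-f) = -gaugeIntegral J f := fun J =>
    BoxIntegral.integral_neg
  rw [ae_restrict_iff' I.measurableSet_coe]
  have hη : ∀ m : ℕ, (0 : ℝ) < 1 / (m + 1) := fun m => by positivity
  -- Countably many `η` suffice; applying the bound to `-f` controls the other side.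
  have hlow := ae_all_iff.2 fun m : ℕ =>
    measure_eq_zero_iff_ae_notMem.1 (volume_frequently_integral_add_le hf (hη m))
  have hupp := ae_all_iff.2 fun m : ℕ =>
    measure_eq_zero_iff_ae_notMem.1
      (volume_frequently_integral_add_le (BoxIntegral.Integrable.neg hf) (hη m))
  filter_upwards [hlow, hupp] with x h₁ h₂ hx
  rw [Metric.tendsto_nhds]
  intro ε hε
  obtain ⟨m, hm⟩ := exists_nat_one_div_lt hε
  have h₁ := h₁ m
  have h₂ := h₂ m
  simp only [not_and, not_frequently] at h₁ h₂
  filter_upwards [h₁ hx, h₂ hx] with k hk₁ hk₂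
  have hpos := volume_coe_box_pos (dyadicBox k I x)
  rw [hneg, Pi.neg_apply] at hk₂
  refine lt_trans ?_ hm
  rw [Real.dist_eq, abs_lt, lt_sub_iff_add_lt, lt_div_iff₀ hpos, sub_lt_iff_lt_add,
    div_lt_iff₀ hpos]
  constructor <;> linarith

theorem GaugeIntegrable.aemeasurable {I : Box (Fin n)} {f : (Fin n → ℝ) → ℝ}
    (hf : GaugeIntegrable I f) : AEMeasurable f (volume.restrict (I : Set (Fin n → ℝ))) :=
  aemeasurable_of_tendsto_metrizable_ae atTop
    (fun k => (measurable_comp_dyadicBox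
      (fun J => gaugeIntegral J f / volume.real (J : Set (Fin n → ℝ))) k I).aemeasurable)
    (ae_tendsto_dyadic_average hf)

/-! ### Comparison with the Lebesgue integral -/

theorem hasGaugeIntegral_of_integrableOn {I : Box (Fin n)} {f : (Fin n → ℝ) → ℝ}
    (hf : IntegrableOn f (I : Set (Fin n → ℝ))) :
    HasGaugeIntegral I f (∫ x in (I : Set (Fin n → ℝ)), f x) :=
  hf.hasBoxIntegral IntegrationParams.Henstock rfl

theorem HasGaugeIntegral.mono {I : Box (Fin n)} {f g : (Fin n → ℝ) → ℝ} {F G : ℝ}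
    (hf : HasGaugeIntegral I f F) (hg : HasGaugeIntegral I g G)
    (hfg : ∀ x ∈ Box.Icc I, f x ≤ g x) : F ≤ G := by
  have h := BoxIntegral.HasIntegral.sub hg hf
  have h0 := BoxIntegral.integral_nonneg (l := IntegrationParams.Henstock) (I := I) (g := g - f)
    (fun x hx => sub_nonneg.2 (hfg x hx)) volume
  exact sub_nonneg.1 (h0.trans_eq h.integral_eq)

/-- A nonnegative gauge integrable function is Lebesgue integrable. -/
theorem HasGaugeIntegral.integrableOn_of_nonneg {I : Box (Fin n)} {f : (Fin n → ℝ) → ℝ} {F : ℝ}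
    (hf : HasGaugeIntegral I f F) (h0 : ∀ x ∈ Box.Icc I, 0 ≤ f x) :
    IntegrableOn f (I : Set (Fin n → ℝ)) := by
  have hmeas : AEMeasurable f (volume.restrict (I : Set (Fin n → ℝ))) :=
    GaugeIntegrable.aemeasurable ⟨F, hf⟩
  have h0' : ∀ᵐ x ∂volume.restrict (I : Set (Fin n → ℝ)), 0 ≤ f x :=
    ae_restrict_of_forall_mem I.measurableSet_coe fun x hx => h0 x (Box.coe_subset_Icc hx)
  have : Fact (volume (I : Set (Fin n → ℝ)) < ∞) := ⟨I.measure_coe_lt_top volume⟩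
  -- Truncations are bounded and measurable, so their Lebesgue and gauge integrals agree and are at
  -- most `F`; Fatou then lets `N` tend to infinity.
  have htrunc : ∀ N : ℕ, IntegrableOn (fun x => min (f x) N) (I : Set (Fin n → ℝ)) := by
    intro N
    refine Integrable.of_bound (hmeas.min aemeasurable_const).aestronglyMeasurable N ?_
    filter_upwards [h0'] with x hx
    rw [Real.norm_of_nonneg (le_min hx N.cast_nonneg)]
    exact min_le_right _ _
  have hlim : ∀ x, Tendsto (fun N : ℕ => min (f x) N) atTop (𝓝 (f x)) := fun x =>
    tendsto_const_nhds.congr' <| by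
      filter_upwards [eventually_ge_atTop ⌈f x⌉₊] with N hN
      exact (min_eq_left ((Nat.le_ceil _).trans (Nat.cast_le.2 hN))).symm
  refine ⟨hmeas.aestronglyMeasurable, ?_⟩
  rw [HasFiniteIntegral, lintegral_congr fun x => (hlim x).enorm.liminf_eq.symm]
  refine lt_of_le_of_lt (lintegral_liminf_le' fun N =>
    (htrunc N).aestronglyMeasurable.aemeasurable.enorm) ?_
  refine lt_of_le_of_lt (liminf_le_of_le (by isBoundedDefault) fun b hb => ?_)
    (ENNReal.ofReal_lt_top (r := F))
  obtain ⟨N, hN⟩ := hb.exists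
  refine hN.trans ?_
  have hnonneg : 0 ≤ᵐ[volume.restrict (I : Set (Fin n → ℝ))] fun x => min (f x) (N : ℝ) :=
    h0'.mono fun x hx => le_min hx N.cast_nonneg
  rw [lintegral_congr_ae (hnonneg.mono fun x hx => Real.enorm_of_nonneg hx),
    ← ofReal_integral_eq_lintegral_ofReal (htrunc N) hnonneg]
  exact ENNReal.ofReal_le_ofReal
    ((hasGaugeIntegral_of_integrableOn (htrunc N)).mono hf fun x _ => min_le_left _ _)

theorem GaugeIntegrable.hasGaugeIntegral {I : Box (Fin n)} {f : (Fin n → ℝ) → ℝ}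
    (hf : GaugeIntegrable I f) : HasGaugeIntegral I f (gaugeIntegral I f) :=
  BoxIntegral.Integrable.hasIntegral hf

/-- The difference of two gauge integrable functions, one of which dominates the other, is
Lebesgue integrable. -/
theorem GaugeIntegrable.integrableOn_sub {I : Box (Fin n)} {f g : (Fin n → ℝ) → ℝ}
    (hf : GaugeIntegrable I f) (hg : GaugeIntegrable I g) (hgf : ∀ x ∈ Box.Icc I, g x ≤ f x) :
    IntegrableOn (fun x => f x - g x) (I : Set (Fin n → ℝ)) :=
  HasGaugeIntegral.integrableOn_of_nonneg
    (BoxIntegral.HasIntegral.sub hf.hasGaugeIntegral hg.hasGaugeIntegral)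
    fun x hx => sub_nonneg.2 (hgf x hx)

theorem GaugeIntegrable.setIntegral_sub {I : Box (Fin n)} {f g : (Fin n → ℝ) → ℝ}
    (hf : GaugeIntegrable I f) (hg : GaugeIntegrable I g) (hgf : ∀ x ∈ Box.Icc I, g x ≤ f x) :
    ∫ x in (I : Set (Fin n → ℝ)), (f x - g x) = gaugeIntegral I f - gaugeIntegral I g :=
  BoxIntegral.HasIntegral.unique
    (hasGaugeIntegral_of_integrableOn (hf.integrableOn_sub hg hgf))
    (BoxIntegral.HasIntegral.sub hf.hasGaugeIntegral hg.hasGaugeIntegral)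

/-! ### Null sets -/

theorem sum_indicator_eq_ofReal_integralSum {I : Box (Fin n)} (X : Set (Fin n → ℝ))
    (π : TaggedPrepartition I) :
    ∑ J ∈ π.boxes, X.indicator (fun _ => volume (J : Set (Fin n → ℝ))) (π.tag J) =
      ENNReal.ofReal (integralSum (X.indicator fun _ => (1 : ℝ)) BoxAdditiveMap.volume π) := by
  have hterm : ∀ J : Box (Fin n), ENNReal.ofReal (BoxAdditiveMap.volume J
      (X.indicator (fun _ => (1 : ℝ)) (π.tag J))) =
        X.indicator (fun _ => volume (J : Set (Fin n → ℝ))) (π.tag J) := by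
    intro J
    rw [boxVolume_apply]
    by_cases h : π.tag J ∈ X
    · simp [h, ofReal_measureReal (J.measure_coe_lt_top volume).ne]
    · simp [h]
  rw [integralSum, ENNReal.ofReal_sum_of_nonneg]
  · exact Finset.sum_congr rfl fun J _ => (hterm J).symm
  · intro J _
    rw [boxVolume_apply]
    exact mul_nonneg measureReal_nonneg (Set.indicator_nonneg (fun _ _ => zero_le_one) _)

theorem integralSum_indicator_nonneg {I : Box (Fin n)} (X : Set (Fin n → ℝ))
    (π : TaggedPrepartition I) :
    0 ≤ integralSum (X.indicator fun _ => (1 : ℝ)) BoxAdditiveMap.volume π :=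
  Finset.sum_nonneg fun J _ => by
    rw [boxVolume_apply]
    exact mul_nonneg measureReal_nonneg (Set.indicator_nonneg (fun _ _ => zero_le_one) _)

theorem outerMeasure_eq_zero_iff {I : Box (Fin n)} {X : Set (Fin n → ℝ)} :
    outerMeasure I X = 0 ↔ HasGaugeIntegral I (X.indicator fun _ => (1 : ℝ)) 0 := by
  rw [HasGaugeIntegral, BoxIntegral.hasIntegral_iff]
  constructor
  · intro h ε hε
    have hlt : outerMeasure I X < ENNReal.ofReal ε := h ▸ ENNReal.ofReal_pos.2 hε
    obtain ⟨δ, hδ⟩ := iInf_lt_iff.1 hlt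
    -- Mathlib's gauges also depend on a distortion bound, which `Henstock` ignores: a constant
    -- family serves here, and the value at `0` in the converse.
    refine ⟨fun _ => δ, fun _ hR => by simp [IntegrationParams.Henstock] at hR,
      fun c π hπ hpart => ?_⟩
    rw [Real.dist_eq, sub_zero, abs_of_nonneg (integralSum_indicator_nonneg X π),
      ← ENNReal.ofReal_le_ofReal_iff hε.le, ← sum_indicator_eq_ofReal_integralSum]
    refine le_trans ?_ hδ.le
    exact le_iSup₂_of_le π hpart (le_iSup₂_of_le (hπ.isHenstock rfl) hπ.isSubordinate le_rfl)
  · intro h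
    refine le_antisymm (ENNReal.le_of_forall_pos_le_add fun ε hε _ => ?_) zero_le
    obtain ⟨r, -, hr⟩ := h ε hε
    rw [zero_add]
    refine iInf_le_of_le (r 0) (iSup₂_le fun π hpart => iSup₂_le fun hH hsub => ?_)
    have hle := hr 0 π ⟨hsub, fun _ => hH, fun h => by simp [IntegrationParams.Henstock] at h,
      fun h => by simp [IntegrationParams.Henstock] at h⟩ hpart
    rw [Real.dist_eq, sub_zero, abs_of_nonneg (integralSum_indicator_nonneg X π)] at hle
    rw [sum_indicator_eq_ofReal_integralSum]
    exact ENNReal.ofReal_le_of_le_toReal hle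

/-- The indicator of the exceptional set is nonnegative, so a zero gauge integral makes it Lebesgue
integrable with integral zero; `X` need not be measurable in advance. -/
theorem almostEverywhere_iff {I : Box (Fin n)} {p : (Fin n → ℝ) → Prop} :
    AlmostEverywhere I p ↔ ∀ᵐ x ∂volume.restrict (I : Set (Fin n → ℝ)), p x := by
  have hiff : (∀ᵐ x ∂volume.restrict (I : Set (Fin n → ℝ)), p x) ↔
      ({x | ¬ p x}.indicator fun _ => (1 : ℝ)) =ᵐ[volume.restrict (I : Set (Fin n → ℝ))] 0 :=
    eventually_congr (ae_of_all _ fun x => by by_cases h : p x <;> simp [h])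
  have hnonneg : ∀ x, 0 ≤ ({x | ¬ p x}.indicator fun _ => (1 : ℝ)) x :=
    Set.indicator_nonneg fun _ _ => zero_le_one
  rw [AlmostEverywhere, outerMeasure_eq_zero_iff, hiff]
  constructor
  · intro h
    have hint := h.integrableOn_of_nonneg fun x _ => hnonneg x
    rw [← integral_eq_zero_iff_of_nonneg hnonneg hint]
    exact BoxIntegral.HasIntegral.unique (hasGaugeIntegral_of_integrableOn hint) h
  · intro h
    exact BoxIntegral.HasIntegral.of_aeEq_zero h rfl

/-! ### Fatou's lemma and dominated convergence -/

/-- Subtracting a real and taking the positive part is monotone and continuous on `EReal`, hence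
commutes with `liminf`. This links Lebesgue's Fatou lemma in `ℝ≥0∞` to lower limits in `EReal`. -/
theorem liminf_ofReal_sub (a : ℕ → ℝ) (b : ℝ) :
    liminf (fun j => ENNReal.ofReal (a j - b)) atTop =
      (liminf (fun j => (a j : EReal)) atTop - b).toENNReal := by
  have hcont : Continuous fun y : EReal => (y - b).toENNReal := by
    refine EReal.continuous_toENNReal.comp (continuous_iff_continuousAt.2 fun y => ?_)
    simp only [sub_eq_add_neg, ← EReal.coe_neg]
    exact (EReal.continuousAt_add (p := (y, ((-b : ℝ) : EReal))) (by simp) (by simp)).comp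
      (f := fun y : EReal => (y, ((-b : ℝ) : EReal)))
      (Continuous.prodMk_left _).continuousAt
  have hmono : Monotone fun y : EReal => (y - b).toENNReal := fun y z hyz =>
    EReal.toENNReal_le_toENNReal (EReal.sub_le_sub hyz le_rfl)
  rw [hmono.map_liminf_of_continuousAt _ hcont.continuousAt]
  refine congrArg (fun u => liminf u atTop) (funext fun j => ?_)
  simp [← EReal.coe_sub, EReal.toENNReal_of_ne_top]

/-- **Fatou's lemma** for the gauge integral. -/
theorem exists_hasExtendedGaugeIntegral_liminf {I : Box (Fin n)} {f : ℕ → (Fin n → ℝ) → ℝ}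
    {g : (Fin n → ℝ) → ℝ} (hf : ∀ j, GaugeIntegrable I (f j)) (hg : GaugeIntegrable I g)
    (hgf : ∀ j, ∀ x ∈ Box.Icc I, g x ≤ f j x)
    (hlim : liminf (fun j => (gaugeIntegral I (f j) : EReal)) atTop ≠ ⊤) :
    ∃ F : ℝ, HasExtendedGaugeIntegral I (fun x => liminf (fun j => (f j x : EReal)) atTop) F ∧
      (F : EReal) ≤ liminf (fun j => (gaugeIntegral I (f j) : EReal)) atTop := by
  set μ := volume.restrict (I : Set (Fin n → ℝ))
  set w : (Fin n → ℝ) → ℝ≥0∞ := fun x => liminf (fun j => ENNReal.ofReal (f j x - g x)) atTop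
    with hw
  have hint : ∀ j, IntegrableOn (fun x => f j x - g x) (I : Set (Fin n → ℝ)) := fun j =>
    (hf j).integrableOn_sub hg (hgf j)
  have hmem : ∀ᵐ x ∂μ, x ∈ (I : Set (Fin n → ℝ)) := ae_restrict_mem I.measurableSet_coe
  have hlintegral : ∀ j, ∫⁻ x, ENNReal.ofReal (f j x - g x) ∂μ =
      ENNReal.ofReal (gaugeIntegral I (f j) - gaugeIntegral I g) := fun j => by
    rw [← (hf j).setIntegral_sub hg (hgf j), ofReal_integral_eq_lintegral_ofReal (hint j)]
    exact hmem.mono fun x hx => sub_nonneg.2 (hgf j x (Box.coe_subset_Icc hx))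
  have hofReal : ∀ j, AEMeasurable (fun x => ENNReal.ofReal (f j x - g x)) μ := fun j =>
    (hint j).aestronglyMeasurable.aemeasurable.ennreal_ofReal
  have hwmeas : AEMeasurable w μ :=
    .congr (Measurable.liminf fun j => (hofReal j).measurable_mk).aemeasurable <| by
      filter_upwards [ae_all_iff.2 fun j => (hofReal j).ae_eq_mk] with x hx
      simp only [hw, hx]
  -- The minorant rules out `⊥`, so the lower limit of the integrals is a real `ℓ`.
  have hge : (gaugeIntegral I g : EReal) ≤
      liminf (fun j => (gaugeIntegral I (f j) : EReal)) atTop :=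
    le_liminf_of_le (by isBoundedDefault) (Eventually.of_forall fun j =>
        EReal.coe_le_coe_iff.2 (hg.hasGaugeIntegral.mono (hf j).hasGaugeIntegral (hgf j)))
  obtain ⟨ℓ, hℓ⟩ : ∃ ℓ : ℝ,
      liminf (fun j => (gaugeIntegral I (f j) : EReal)) atTop = ℓ :=
    ⟨_, (EReal.coe_toReal hlim (ne_bot_of_le_ne_bot (EReal.coe_ne_bot _) hge)).symm⟩
  have hgℓ : gaugeIntegral I g ≤ ℓ := EReal.coe_le_coe_iff.1 (hℓ ▸ hge)
  have hwle : ∫⁻ x, w x ∂μ ≤ ENNReal.ofReal (ℓ - gaugeIntegral I g) := by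
    refine (lintegral_liminf_le' hofReal).trans_eq ?_
    rw [funext hlintegral, liminf_ofReal_sub, hℓ, ← EReal.coe_sub,
      EReal.toENNReal_of_ne_top (EReal.coe_ne_top _), EReal.toReal_coe]
  have hwfin : ∫⁻ x, w x ∂μ ≠ ∞ := (hwle.trans_lt ENNReal.ofReal_lt_top).ne
  have hwlt : ∀ᵐ x ∂μ, w x < ∞ := ae_lt_top' hwmeas hwfin
  -- Since the lower limit is at least `g x`, the positive part in `w` loses nothing.
  have hpoint : ∀ᵐ x ∂μ, ∃ y : ℝ, liminf (fun j => (f j x : EReal)) atTop = y ∧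
      y = g x + (w x).toReal := by
    filter_upwards [hwlt, hmem] with x hx hxI
    have hge : (g x : EReal) ≤ liminf (fun j => (f j x : EReal)) atTop :=
      le_liminf_of_le (by isBoundedDefault) (Eventually.of_forall fun j =>
        EReal.coe_le_coe_iff.2 (hgf j x (Box.coe_subset_Icc hxI)))
    have hwx := liminf_ofReal_sub (fun j => f j x) (g x)
    change w x = _ at hwx
    have htop : liminf (fun j => (f j x : EReal)) atTop ≠ ⊤ := by
      intro h
      rw [h, EReal.top_sub_coe, EReal.toENNReal_top] at hwx
      exact hx.ne hwx
    obtain ⟨y, hy⟩ : ∃ y : ℝ, liminf (fun j => (f j x : EReal)) atTop = y :=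
      ⟨_, (EReal.coe_toReal htop (ne_bot_of_le_ne_bot (EReal.coe_ne_bot _) hge)).symm⟩
    refine ⟨y, hy, ?_⟩
    rw [hy, EReal.coe_le_coe_iff] at hge
    rw [hwx, hy, ← EReal.coe_sub, EReal.toENNReal_of_ne_top (EReal.coe_ne_top _),
      EReal.toReal_coe, ENNReal.toReal_ofReal (sub_nonneg.2 hge)]
    ring
  have hwint : IntegrableOn (fun x => (w x).toReal) (I : Set (Fin n → ℝ)) :=
    integrable_toReal_of_lintegral_ne_top hwmeas hwfin
  refine ⟨gaugeIntegral I g + ∫ x in (I : Set (Fin n → ℝ)), (w x).toReal, ⟨?_, ?_⟩, ?_⟩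
  · refine almostEverywhere_iff.2 (hpoint.mono fun x hx => ?_)
    obtain ⟨y, hy, -⟩ := hx
    simp [hy]
  · refine BoxIntegral.HasIntegral.congr_ae (BoxIntegral.HasIntegral.add hg.hasGaugeIntegral
      (hasGaugeIntegral_of_integrableOn hwint)) (hpoint.mono fun x hx => ?_) rfl
    obtain ⟨y, hy, hy'⟩ := hx
    change g x + (w x).toReal = (liminf (fun j => (f j x : EReal)) atTop).toReal
    rw [hy, EReal.toReal_coe, hy']
  · rw [hℓ, EReal.coe_le_coe_iff, integral_toReal hwmeas hwlt]
    have := ENNReal.toReal_mono ENNReal.ofReal_ne_top hwle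
    rw [ENNReal.toReal_ofReal (sub_nonneg.2 hgℓ)] at this
    linarith

theorem le_liminf_of_hasExtendedGaugeIntegral {I : Box (Fin n)} {f : ℕ → (Fin n → ℝ) → ℝ}
    {g : (Fin n → ℝ) → ℝ} (hf : ∀ j, GaugeIntegrable I (f j)) (hg : GaugeIntegrable I g)
    (hgf : ∀ j, ∀ x ∈ Box.Icc I, g x ≤ f j x) {F : ℝ}
    (hF : HasExtendedGaugeIntegral I (fun x => liminf (fun j => (f j x : EReal)) atTop) F) :
    (F : EReal) ≤ liminf (fun j => (gaugeIntegral I (f j) : EReal)) atTop := by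
  by_cases hlim : liminf (fun j => (gaugeIntegral I (f j) : EReal)) atTop = ⊤
  · exact hlim ▸ le_top
  · obtain ⟨F', hF', hle⟩ := exists_hasExtendedGaugeIntegral_liminf hf hg hgf hlim
    -- The integral is unique, so the given `F` is the one Fatou's lemma produces.
    rwa [BoxIntegral.HasIntegral.unique hF.2 hF'.2]

theorem HasExtendedGaugeIntegral.neg {I : Box (Fin n)} {φ : (Fin n → ℝ) → EReal} {F : ℝ}
    (h : HasExtendedGaugeIntegral I φ F) :
    HasExtendedGaugeIntegral I (fun x => -φ x) (-F) := by
  refine ⟨?_, ?_⟩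
  · simpa [and_comm] using h.1
  · have hφ : (fun x => (-φ x).toReal) = -fun x => (φ x).toReal :=
      funext fun _ => EReal.toReal_neg_eq
    rw [hφ]
    exact BoxIntegral.HasIntegral.neg h.2

theorem liminf_coe_neg (a : ℕ → ℝ) :
    liminf (fun j => ((-a j : ℝ) : EReal)) atTop = -limsup (fun j => (a j : EReal)) atTop := by
  rw [← EReal.liminf_neg]
  rfl

/-- Dominated convergence for the gauge integral. -/
theorem exists_hasGaugeIntegral_tendsto {I : Box (Fin n)} {f : ℕ → (Fin n → ℝ) → ℝ}
    {g₁ g₂ f' : (Fin n → ℝ) → ℝ} (hf : ∀ j, GaugeIntegrable I (f j))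
    (hg₁ : GaugeIntegrable I g₁) (hg₂ : GaugeIntegrable I g₂)
    (hbound : ∀ j, ∀ x ∈ Box.Icc I, g₁ x ≤ f j x ∧ f j x ≤ g₂ x)
    (hlim : AlmostEverywhere I fun x => Tendsto (fun j => f j x) atTop (𝓝 (f' x))) :
    ∃ F : ℝ, HasGaugeIntegral I f' F ∧
      Tendsto (fun j => gaugeIntegral I (f j)) atTop (𝓝 F) := by
  set μ := volume.restrict (I : Set (Fin n → ℝ))
  have hint : ∀ j, IntegrableOn (fun x => f j x - g₁ x) (I : Set (Fin n → ℝ)) := fun j =>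
    (hf j).integrableOn_sub hg₁ fun x hx => (hbound j x hx).1
  have hint' : IntegrableOn (fun x => g₂ x - g₁ x) (I : Set (Fin n → ℝ)) :=
    hg₂.integrableOn_sub hg₁ fun x hx => (hbound 0 x hx).1.trans (hbound 0 x hx).2
  have hnorm : ∀ᵐ x ∂μ, ∀ j, ‖f j x - g₁ x‖ ≤ g₂ x - g₁ x := by
    filter_upwards [ae_restrict_mem I.measurableSet_coe] with x hx j
    obtain ⟨h₁, h₂⟩ := hbound j x (Box.coe_subset_Icc hx)
    rw [Real.norm_of_nonneg (sub_nonneg.2 h₁)]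
    exact sub_le_sub_right h₂ _
  have hlim' : ∀ᵐ x ∂μ, Tendsto (fun j => f j x - g₁ x) atTop (𝓝 (f' x - g₁ x)) :=
    (almostEverywhere_iff.1 hlim).mono fun x hx => hx.sub_const _
  have hlimint : IntegrableOn (fun x => f' x - g₁ x) (I : Set (Fin n → ℝ)) := by
    refine Integrable.mono' hint'
      (aestronglyMeasurable_of_tendsto_ae atTop (fun j => (hint j).aestronglyMeasurable) hlim') ?_
    filter_upwards [hnorm, hlim'] with x hx hx'
    exact le_of_tendsto' hx'.norm hx
  have htendsto := tendsto_integral_of_dominated_convergence (fun x => g₂ x - g₁ x)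
    (fun j => (hint j).aestronglyMeasurable) hint' (fun j => hnorm.mono fun x hx => hx j) hlim'
  refine ⟨gaugeIntegral I g₁ + ∫ x in (I : Set (Fin n → ℝ)), (f' x - g₁ x), ?_, ?_⟩
  · refine BoxIntegral.HasIntegral.congr_ae (BoxIntegral.HasIntegral.add hg₁.hasGaugeIntegral
      (hasGaugeIntegral_of_integrableOn hlimint)) (ae_of_all _ fun x => ?_) rfl
    simp
  · refine (htendsto.const_add (gaugeIntegral I g₁)).congr fun j => ?_
    rw [(hf j).setIntegral_sub hg₁ fun x hx => (hbound j x hx).1]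
    ring

end GaugeIntegral

theorem mainTheorem4 (n : ℕ) (I : BoxIntegral.Box (Fin n)) (f : ℕ → (Fin n → ℝ) → ℝ)
    (hf : ∀ j, GaugeIntegral.GaugeIntegrable I (f j)) :
    -- Fatou's lemma for the lower limit
    (∀ g₁ : (Fin n → ℝ) → ℝ, GaugeIntegral.GaugeIntegrable I g₁ →
      (∀ j, ∀ P ∈ BoxIntegral.Box.Icc I, g₁ P ≤ f j P) →
      (∀ F : ℝ, GaugeIntegral.HasExtendedGaugeIntegral I
          (fun P => liminf (fun j => (f j P : EReal)) atTop) F →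
        (F : EReal) ≤ liminf (fun j => (GaugeIntegral.gaugeIntegral I (f j) : EReal)) atTop) ∧
      (liminf (fun j => (GaugeIntegral.gaugeIntegral I (f j) : EReal)) atTop ≠ ⊤ →
        ∃ F : ℝ, GaugeIntegral.HasExtendedGaugeIntegral I
          (fun P => liminf (fun j => (f j P : EReal)) atTop) F)) ∧
    -- Fatou's lemma for the upper limit
    (∀ g₂ : (Fin n → ℝ) → ℝ, GaugeIntegral.GaugeIntegrable I g₂ →
      (∀ j, ∀ P ∈ BoxIntegral.Box.Icc I, f j P ≤ g₂ P) →
      (∀ F : ℝ, GaugeIntegral.HasExtendedGaugeIntegral I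
          (fun P => limsup (fun j => (f j P : EReal)) atTop) F →
        limsup (fun j => (GaugeIntegral.gaugeIntegral I (f j) : EReal)) atTop ≤ (F : EReal)) ∧
      (limsup (fun j => (GaugeIntegral.gaugeIntegral I (f j) : EReal)) atTop ≠ ⊥ →
        ∃ F : ℝ, GaugeIntegral.HasExtendedGaugeIntegral I
          (fun P => limsup (fun j => (f j P : EReal)) atTop) F)) ∧
    -- majorised convergence
    (∀ g₁ g₂ f' : (Fin n → ℝ) → ℝ, GaugeIntegral.GaugeIntegrable I g₁ →
      GaugeIntegral.GaugeIntegrable I g₂ →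
      (∀ j, ∀ P ∈ BoxIntegral.Box.Icc I, g₁ P ≤ f j P ∧ f j P ≤ g₂ P) →
      GaugeIntegral.AlmostEverywhere I (fun P => Tendsto (fun j => f j P) atTop (𝓝 (f' P))) →
      ∃ F : ℝ, GaugeIntegral.HasGaugeIntegral I f' F ∧
        Tendsto (fun j => GaugeIntegral.gaugeIntegral I (f j)) atTop (𝓝 F)) := by
  have hneg : ∀ j, GaugeIntegral.gaugeIntegral I (fun P => -f j P) =
      -GaugeIntegral.gaugeIntegral I (f j) := fun j => BoxIntegral.integral_neg
  have hfneg : ∀ j, GaugeIntegral.GaugeIntegrable I (fun P => -f j P) := fun j =>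
    BoxIntegral.Integrable.neg (hf j)
  refine ⟨fun g₁ hg₁ hle => ⟨fun F hF => ?_, fun hlim => ?_⟩,
    fun g₂ hg₂ hle => ⟨fun F hF => ?_, fun hlim => ?_⟩,
    fun g₁ g₂ f' hg₁ hg₂ hbound hlim =>
      GaugeIntegral.exists_hasGaugeIntegral_tendsto hf hg₁ hg₂ hbound hlim⟩
  · exact GaugeIntegral.le_liminf_of_hasExtendedGaugeIntegral hf hg₁ hle hF
  · obtain ⟨F, hF, -⟩ :=
      GaugeIntegral.exists_hasExtendedGaugeIntegral_liminf hf hg₁ hle hlim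
    exact ⟨F, hF⟩
  -- The upper-limit case is the lower-limit case for `-f j` with minorant `-g₂`.
  · have h := GaugeIntegral.le_liminf_of_hasExtendedGaugeIntegral hfneg
      (BoxIntegral.Integrable.neg hg₂) (fun j P hP => neg_le_neg (hle j P hP)) (F := -F) (by
        simp only [GaugeIntegral.liminf_coe_neg]
        exact hF.neg)
    simp only [hneg, GaugeIntegral.liminf_coe_neg] at h
    rwa [EReal.coe_neg, EReal.neg_le_neg_iff] at h
  · obtain ⟨F, hF, -⟩ := GaugeIntegral.exists_hasExtendedGaugeIntegral_liminf hfneg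
      (BoxIntegral.Integrable.neg hg₂) (fun j P hP => neg_le_neg (hle j P hP)) (by
        simp only [hneg, GaugeIntegral.liminf_coe_neg]
        rwa [Ne, EReal.neg_eq_top_iff])
    refine ⟨-F, ?_⟩
    simp only [GaugeIntegral.liminf_coe_neg] at hF
    simpa only [neg_neg] using hF.neg
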